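/- Let $f,g\in\mathbb{Z}[x]$ be products of cyclotomic polynomials (repetitions allowed), both of degree $n$, with no common complex root and with $f(0)=-1$, $g(0)=1$. Let $V=\mathbb{Q}[x]/(f)$, let $A:V\to V$ be multiplication by $x$, and let $B:V\to V$ be the linear map with $B(x^i)=x^{i+1}$ for $0\le i\le n-2$ and $B(x^{n-1})=x^n-g(x)$; so in the basis $1,x,\dots,x^{n-1}$ the matrices of $A,B$ are the companion matrices of $f,g$. For a symmetric bilinear form over a field $K$, its $K$-rank is the largest dimension of a totally isotropic $K$-subspace. Suppose that $f$ or $g$ is divisible in $\mathbb{C}[x]$ by the square of a quadratic polynomial (i.e. two of its roots occur with multiplicity two). Then there is a nonzero symmetric bilinear form $h$ on $V$ that is preserved by $A$ and $B$; it is unique up to a scalar factor and non-degenerate. Every such $h$ satisfies $\mathbb{R}\text{-rank}(V\otimes_{\mathbb{Q}}\mathbb{R},h)\ge 2$, and if moreover $n\ge 7$, then $\mathbb{Q}\text{-rank}(V,h)\ge 2$. -/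

import Mathlib

open Polynomial TensorProduct

/-- A product of cyclotomic polynomials (with repetitions allowed), in `ℤ[x]`. -/
def IsCyclotomicProduct (f : ℤ[X]) : Prop :=
  ∃ s : Multiset ℕ, (∀ k ∈ s, 0 < k) ∧ f = (s.map fun k => cyclotomic k ℤ).prod

theorem IsCyclotomicProduct.monic {f : ℤ[X]} (hf : IsCyclotomicProduct f) : f.Monic := by
  obtain ⟨s, -, rfl⟩ := hf
  exact monic_multiset_prod_of_monic s _ fun k _ => cyclotomic.monic k ℤ

/-- The `ℚ`-algebra `V = ℚ[x]/(f)`. -/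
abbrev HypergeometricSpace (f : ℤ[X]) : Type :=
  AdjoinRoot (f.map (Int.castRingHom ℚ))

/-- The operator `A` of multiplication by `x` on `V = ℚ[x]/(f)`; its matrix in the basis
`1, x, …, x^(n-1)` is the companion matrix of `f`. -/
noncomputable def hypergeometricA (f : ℤ[X]) :
    HypergeometricSpace f →ₗ[ℚ] HypergeometricSpace f :=
  LinearMap.mulLeft ℚ (AdjoinRoot.root (f.map (Int.castRingHom ℚ)))

/-- The linear form `u₀ + u₁ x + ⋯ + u_(n-1) x^(n-1) ↦ u_(n-1)` on `V = ℚ[x]/(f)`, where `f` is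
monic of degree `n`. -/
noncomputable def topCoeff {f : ℤ[X]} (hf : f.Monic) : HypergeometricSpace f →ₗ[ℚ] ℚ :=
  (lcoeff ℚ (f.natDegree - 1)).comp
    (AdjoinRoot.modByMonicHom (hf.map (Int.castRingHom ℚ)))

/-- The operator `B` on `V = ℚ[x]/(f)`: it agrees with `A` on `1, x, …, x^(n-2)`, and it sends
`x^(n-1)` to `x^n - g`. In the basis `1, x, …, x^(n-1)` its matrix is the companion matrix of `g`
when `g` is monic of the same degree `n`. -/
noncomputable def hypergeometricB {f : ℤ[X]} (hf : f.Monic) (g : ℤ[X]) :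
    HypergeometricSpace f →ₗ[ℚ] HypergeometricSpace f :=
  hypergeometricA f - (topCoeff hf).smulRight
    (AdjoinRoot.mk (f.map (Int.castRingHom ℚ)) (g.map (Int.castRingHom ℚ)))

/-- `h` is a symmetric bilinear form (equivalently, a quadratic form) on `V = ℚ[x]/(f)` that is
preserved by `A` and `B`. -/
structure IsHypergeometricForm {f : ℤ[X]} (hf : f.Monic) (g : ℤ[X])
    (h : LinearMap.BilinForm ℚ (HypergeometricSpace f)) : Prop where
  symm : ∀ w w', h w w' = h w' w
  map_A : ∀ w w', h (hypergeometricA f w) (hypergeometricA f w') = h w w'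
  map_B : ∀ w w', h (hypergeometricB hf g w) (hypergeometricB hf g w') = h w w'

/-- The `K`-rank (Witt index) of a symmetric bilinear form on a finite-dimensional vector space
over `K`: the largest dimension of a totally isotropic subspace. -/
noncomputable def formRank {K V : Type*} [Field K] [AddCommGroup V] [Module K V]
    (h : LinearMap.BilinForm K V) : ℕ :=
  sSup {d : ℕ | ∃ W : Submodule K V,
    (∀ x ∈ W, ∀ y ∈ W, h x y = 0) ∧ Module.finrank K W = d}

/-!
Write `F` and `G` for `f` and `g` over `ℚ`, `V = ℚ[x]/(F)`, and `ℓ` for the top coefficient form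
on `V`. Then `A u = x * u` and `B u = x * u - ℓ u • g`.

*The invariant form.* Cyclotomic polynomials are reciprocal, so `f(0) = -1` and `g(0) = 1` say that
`F` is antipalindromic and `G` palindromic. Hence `V` has an involution `σ` with `σ x = x⁻¹`, and
`σ g = x⁻ⁿ * g`. Since `f` and `g` have no common root, `g` is a unit of `V`, and
`h(a, b) = ℓ (x ^ (n - 1) * g⁻¹ * σ a * b)` is a form preserved by `A`. It is symmetric because
`ℓ (x ^ (n - 2) * σ a) = ℓ a`, and non-degenerate because `ℓ` is. With `w = x⁻¹ * g` it satisfies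
`h(w, b) = ℓ b` and `ℓ w = 2`, so `A⁻¹ B = 1 - ℓ • w` is the reflection in `w` and preserves `h`.
Conversely an arbitrary invariant form satisfies `h(w, b) = c * ℓ b` for a constant `c`, and by
`A`-invariance this determines it on the vectors `x ^ i * w`, which span `V`; hence uniqueness
(`InvolutiveDatum.eq_smul_form`).

*The rank.* A complex quadratic square factor of `f` or `g` forces a factorization `f = p ^ 2 * t`
or `g = p ^ 2 * t` with `p`, `t` products of cyclotomic polynomials and `p` of degree at least two
(`IsCyclotomicProduct.exists_eq_sq_mul`). Let `T` be `A` or `B` accordingly; it is annihilated by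
`p ^ 2 * t`. The adjoint of `(p * t)(T)` is, up to sign, a power of `T⁻¹` times `(p * t)(T)`,
because `p * t` is reciprocal, and `(p * t) ^ 2` is divisible by `p ^ 2 * t`. So the range of
`(p * t)(T)` is totally isotropic. It contains the vectors `(p * t * X ^ i)(T) 1`, `i < deg p`, which are
independent because `T ^ i 1 = x ^ i` for `i < n` (`exists_isotropic_of_isometry`). This gives a
rational isotropic subspace of dimension at least two, in any degree `n`, and its extension of
scalars is a real one.
-/

/-! ### Reciprocal polynomials and products of cyclotomic polynomials -/

/-- A polynomial is reciprocal if reversing the order of its coefficients changes it at most by a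
sign. -/
def IsReciprocal {R : Type*} [Ring R] (p : R[X]) : Prop :=
  p.reverse = p ∨ p.reverse = -p

namespace IsReciprocal

variable {R : Type*} [CommRing R] [IsDomain R] {p q : R[X]}

theorem mul (hp : IsReciprocal p) (hq : IsReciprocal q) : IsReciprocal (p * q) := by
  unfold IsReciprocal
  rw [reverse_mul_of_domain]
  rcases hp with hp | hp <;> rcases hq with hq | hq <;> simp [hp, hq]

theorem of_mul_left (hp : IsReciprocal p) (hp0 : p ≠ 0) (hpq : IsReciprocal (p * q)) :
    IsReciprocal q := by
  unfold IsReciprocal at hpq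
  rw [reverse_mul_of_domain] at hpq
  have key : p * q.reverse = p * q ∨ p * q.reverse = p * -q := by
    rcases hp with hp | hp <;> rw [hp] at hpq
    · simpa using hpq
    · rcases hpq with h | h
      · exact Or.inr (by linear_combination -h)
      · exact Or.inl (by linear_combination -h)
  exact key.imp (mul_left_cancel₀ hp0) (mul_left_cancel₀ hp0)

theorem finset_prod {ι : Type*} (s : Finset ι) (φ : ι → R[X])
    (h : ∀ i ∈ s, IsReciprocal (φ i)) : IsReciprocal (∏ i ∈ s, φ i) :=
  Finset.prod_induction φ IsReciprocal (fun _ _ => mul)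
    (Or.inl (by simpa using reverse_C (1 : R))) h

theorem multiset_prod (s : Multiset R[X]) (h : ∀ p ∈ s, IsReciprocal p) :
    IsReciprocal s.prod :=
  Multiset.prod_induction IsReciprocal s (fun _ _ => mul)
    (Or.inl (by simpa using reverse_C (1 : R))) h

end IsReciprocal

theorem isReciprocal_X_pow_sub_one (n : ℕ) : IsReciprocal (X ^ n - 1 : ℤ[X]) := by
  right
  have hd : (X ^ n - 1 : ℤ[X]).natDegree = n := by
    simpa using natDegree_X_pow_sub_C (n := n) (r := (1 : ℤ))
  rw [reverse, hd, reflect_sub, reflect_monomial, reflect_one, revAt_le le_rfl]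
  simp

/-- Cancel the cyclotomic factors of lower order in `X ^ n - 1 = ∏ d ∣ n, Φ_d`. -/
theorem isReciprocal_cyclotomic {n : ℕ} (hn : 0 < n) : IsReciprocal (cyclotomic n ℤ) := by
  induction n using Nat.strong_induction_on with
  | _ n ih =>
    have hprod := prod_cyclotomic_eq_X_pow_sub_one hn ℤ
    rw [← Nat.cons_self_properDivisors hn.ne', Finset.prod_cons, mul_comm] at hprod
    refine IsReciprocal.of_mul_left (IsReciprocal.finset_prod n.properDivisors _ fun d hd => ?_)
      (Finset.prod_ne_zero_iff.mpr fun d _ => cyclotomic_ne_zero d ℤ)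
      (hprod ▸ isReciprocal_X_pow_sub_one n)
    exact ih d (Nat.mem_properDivisors.mp hd).2 (Nat.pos_of_mem_properDivisors hd)

theorem IsCyclotomicProduct.isReciprocal {f : ℤ[X]} (hf : IsCyclotomicProduct f) :
    IsReciprocal f := by
  obtain ⟨s, hs, rfl⟩ := hf
  refine IsReciprocal.multiset_prod _ fun p hp => ?_
  obtain ⟨k, hk, rfl⟩ := Multiset.mem_map.mp hp
  exact isReciprocal_cyclotomic (hs k hk)

/-- For a monic reciprocal polynomial the sign is the constant coefficient. -/
theorem IsReciprocal.reverse_eq {f : ℤ[X]} (hf : IsReciprocal f) (hm : f.Monic) :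
    f.reverse = C (f.eval 0) * f := by
  have h0 : f.reverse.coeff 0 = 1 := by rw [coeff_zero_reverse, hm.leadingCoeff]
  rw [← coeff_zero_eq_eval_zero]
  rcases hf with hf | hf <;> rw [hf] at h0 ⊢
  · simp [h0]
  · have : f.coeff 0 = -1 := by simpa [neg_eq_iff_eq_neg] using h0
    simp [this]

theorem eq_of_aeval_cyclotomic_eq_zero {k j : ℕ} (hk : 0 < k) (hj : 0 < j) {z : ℂ}
    (hzk : aeval z (cyclotomic k ℤ) = 0) (hzj : aeval z (cyclotomic j ℤ) = 0) : k = j := by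
  have key : ∀ m : ℕ, 0 < m → aeval z (cyclotomic m ℤ) = 0 → IsPrimitiveRoot z m := by
    intro m hm h
    have : NeZero (m : ℂ) := ⟨by exact_mod_cast hm.ne'⟩
    rw [← isRoot_cyclotomic_iff, IsRoot, ← map_cyclotomic_int, eval_map,
      ← algebraMap_int_eq, ← aeval_def]
    exact h
  exact (key k hk hzk).unique (key j hj hzj)

theorem exists_mem_aeval_cyclotomic_eq_zero {s : Multiset ℕ} {z : ℂ}
    (h : aeval z (s.map fun k => cyclotomic k ℤ).prod = 0) :
    ∃ k ∈ s, aeval z (cyclotomic k ℤ) = 0 := by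
  rw [map_multiset_prod, Multiset.prod_eq_zero_iff, Multiset.map_map] at h
  obtain ⟨k, hk, h⟩ := Multiset.mem_map.mp h
  exact ⟨k, hk, h⟩

theorem X_sub_C_dvd_map_iff {z : ℂ} {f : ℤ[X]} :
    X - C z ∣ f.map (Int.castRingHom ℂ) ↔ aeval z f = 0 := by
  rw [dvd_iff_isRoot, IsRoot, eval_map, ← algebraMap_int_eq, ← aeval_def]

/-- Cyclotomic polynomials are squarefree and pairwise without common roots, so a double root of
a product of them comes from a repeated factor. -/
theorem exists_eq_cons_cons_of_sq_dvd {s : Multiset ℕ} (hs : ∀ k ∈ s, 0 < k) {z : ℂ}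
    (h : (X - C z) ^ 2 ∣ ((s.map fun k => cyclotomic k ℤ).prod).map (Int.castRingHom ℂ)) :
    ∃ k t, s = k ::ₘ k ::ₘ t ∧ aeval z (cyclotomic k ℤ) = 0 := by
  obtain ⟨k, hk, hzk⟩ := exists_mem_aeval_cyclotomic_eq_zero
    (X_sub_C_dvd_map_iff.mp ((dvd_pow_self _ two_ne_zero).trans h))
  obtain ⟨s', rfl⟩ := Multiset.exists_cons_of_mem hk
  have hz' : aeval z (s'.map fun k => cyclotomic k ℤ).prod = 0 := by
    by_contra hne
    rw [Multiset.map_cons, Multiset.prod_cons, Polynomial.map_mul] at h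
    have h2 := (prime_X_sub_C z).pow_dvd_of_dvd_mul_right 2
      (fun hd => hne (X_sub_C_dvd_map_iff.mp hd)) h
    have : NeZero (k : ℂ) := ⟨by exact_mod_cast (hs k hk).ne'⟩
    have hsq : Squarefree (cyclotomic k ℂ) := (separable_cyclotomic k ℂ).squarefree
    rw [map_cyclotomic_int, pow_two] at h2
    exact (prime_X_sub_C z).not_isUnit (hsq _ h2)
  obtain ⟨j, hj, hzj⟩ := exists_mem_aeval_cyclotomic_eq_zero hz'
  obtain rfl := eq_of_aeval_cyclotomic_eq_zero (hs k hk)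
    (hs j (Multiset.mem_cons_of_mem hj)) hzk hzj
  obtain ⟨t, rfl⟩ := Multiset.exists_cons_of_mem hj
  exact ⟨k, t, rfl, hzk⟩

theorem X_sub_C_dvd_of_natDegree_pos {q : ℂ[X]} (hq : 0 < q.natDegree) : ∃ z, X - C z ∣ q := by
  obtain ⟨z, hz⟩ := IsAlgClosed.exists_root q (natDegree_pos_iff_degree_pos.mp hq).ne'
  exact ⟨z, dvd_iff_isRoot.mpr hz⟩

/-- A complex quadratic square factor of a product of cyclotomic polynomials can be replaced by
an integral one, the square of a product of cyclotomic polynomials of degree at least two. -/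
theorem IsCyclotomicProduct.exists_eq_sq_mul {f : ℤ[X]} (hf : IsCyclotomicProduct f) {q : ℂ[X]}
    (hq : q.natDegree = 2) (hqf : q ^ 2 ∣ f.map (Int.castRingHom ℂ)) :
    ∃ p t : ℤ[X], IsCyclotomicProduct p ∧ IsCyclotomicProduct t ∧ f = p ^ 2 * t ∧
      2 ≤ p.natDegree := by
  obtain ⟨s, hs, rfl⟩ := hf
  obtain ⟨z, q', rfl⟩ := X_sub_C_dvd_of_natDegree_pos (hq ▸ two_pos)
  obtain ⟨k, t, rfl, hz⟩ := exists_eq_cons_cons_of_sq_dvd hs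
    ((pow_dvd_pow_of_dvd (dvd_mul_right _ q') 2).trans hqf)
  have hk : 0 < k := hs k (Multiset.mem_cons_self _ _)
  have ht : ∀ j ∈ t, 0 < j := fun j hj =>
    hs j (Multiset.mem_cons_of_mem (Multiset.mem_cons_of_mem hj))
  have hprod : ((k ::ₘ k ::ₘ t).map fun k => cyclotomic k ℤ).prod =
      cyclotomic k ℤ ^ 2 * (t.map fun k => cyclotomic k ℤ).prod := by
    simp only [Multiset.map_cons, Multiset.prod_cons]; ring
  rw [hprod] at hqf ⊢
  by_cases hdeg : 2 ≤ k.totient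
  · exact ⟨cyclotomic k ℤ, _, ⟨{k}, by simpa using hk, by simp⟩, ⟨t, ht, rfl⟩, rfl,
      by rwa [natDegree_cyclotomic]⟩
  -- Otherwise `Φ_k` is linear, and the remaining root of `q` provides a second square factor.
  have hk1 : k.totient = 1 := by have := Nat.totient_pos.mpr hk; omega
  have hlin : X - C z = (cyclotomic k ℤ).map (Int.castRingHom ℂ) := by
    refine (eq_of_monic_of_dvd_of_natDegree_le (monic_X_sub_C z)
      ((cyclotomic.monic k ℤ).map _) (X_sub_C_dvd_map_iff.mpr hz) ?_).symm
    rw [(cyclotomic.monic k ℤ).natDegree_map, natDegree_cyclotomic, hk1, natDegree_X_sub_C]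
  have hq'0 : q' ≠ 0 := by rintro rfl; simp at hq
  have hq' : q'.natDegree = 1 := by
    rw [natDegree_mul (X_sub_C_ne_zero z) hq'0, natDegree_X_sub_C] at hq
    omega
  obtain ⟨z', hz'⟩ := X_sub_C_dvd_of_natDegree_pos (hq' ▸ one_pos)
  rw [Polynomial.map_mul, Polynomial.map_pow, ← hlin, mul_pow] at hqf
  have hq't := (mul_dvd_mul_iff_left (pow_ne_zero 2 (X_sub_C_ne_zero z))).mp hqf
  obtain ⟨j, u, rfl, -⟩ := exists_eq_cons_cons_of_sq_dvd ht
    ((pow_dvd_pow_of_dvd hz' 2).trans hq't)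
  have hj : 0 < j := ht j (Multiset.mem_cons_self _ _)
  refine ⟨cyclotomic k ℤ * cyclotomic j ℤ, (u.map fun k => cyclotomic k ℤ).prod,
    ⟨{k, j}, by simp [hk, hj], by simp⟩, ⟨u, fun i hi => ht i (by simp [hi]), rfl⟩, ?_, ?_⟩
  · simp only [Multiset.map_cons, Multiset.prod_cons]; ring
  · rw [natDegree_mul (cyclotomic_ne_zero k ℤ) (cyclotomic_ne_zero j ℤ), natDegree_cyclotomic,
      natDegree_cyclotomic]
    have := Nat.totient_pos.mpr hk
    have := Nat.totient_pos.mpr hj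
    omega

/-! ### Isotropic subspaces and rank -/

theorem le_formRank {K V : Type*} [Field K] [AddCommGroup V] [Module K V] [FiniteDimensional K V]
    {h : LinearMap.BilinForm K V} (W : Submodule K V) (hW : ∀ x ∈ W, ∀ y ∈ W, h x y = 0) :
    Module.finrank K W ≤ formRank h := by
  refine le_csSup ⟨Module.finrank K V, ?_⟩ ⟨W, hW, rfl⟩
  rintro d ⟨U, -, rfl⟩
  exact U.finrank_le

/-- Extension of scalars carries totally isotropic subspaces to totally isotropic subspaces of the
same dimension. -/
theorem le_formRank_baseChange {K L V : Type*} [Field K] [Field L] [Algebra K L] [AddCommGroup V]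
    [Module K V] [FiniteDimensional K V] {h : LinearMap.BilinForm K V} (W : Submodule K V)
    (hW : ∀ x ∈ W, ∀ y ∈ W, h x y = 0) :
    Module.finrank K W ≤ formRank (LinearMap.BilinForm.baseChange L h) := by
  have hinj : Function.Injective (W.subtype.baseChange L) :=
    Module.Flat.lTensor_preserves_injective_linearMap W.subtype W.injective_subtype
  have hrank := LinearMap.finrank_range_of_inj hinj
  rw [Module.finrank_baseChange] at hrank
  rw [← hrank]
  refine le_formRank _ ?_
  rintro _ ⟨x, rfl⟩ _ ⟨y, rfl⟩
  induction x with
  | zero => simp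
  | add x x' hx hx' => rw [map_add, map_add, LinearMap.add_apply, hx, hx', add_zero]
  | tmul a w =>
    induction y with
    | zero => simp
    | add y y' hy hy' => rw [map_add, map_add, hy, hy', add_zero]
    | tmul b w' => simp [hW w w.2 w' w'.2]

section Isometry

variable {K V : Type*} [Field K] [AddCommGroup V] [Module K V] {h : LinearMap.BilinForm K V}
  {T : Module.End K V}

theorem apply_pow_pow_of_isometry (hT : ∀ u v, h (T u) (T v) = h u v) (i : ℕ) (u v : V) :
    h ((T ^ i) u) ((T ^ i) v) = h u v := by
  induction i with
  | zero => simp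
  | succ i ih => rw [pow_succ', Module.End.mul_apply, Module.End.mul_apply, hT, ih]

/-- The adjoint of `r(T)` is `r(T⁻¹)`, which up to a power of `T` is `r.reverse` evaluated at
`T`. -/
theorem apply_aeval_eq_apply_aeval_reverse (hT : ∀ u v, h (T u) (T v) = h u v) (r : K[X])
    (u v : V) :
    h (aeval T r u) ((T ^ r.natDegree) v) = h u (aeval T r.reverse v) := by
  rw [aeval_eq_sum_range, aeval_eq_sum_range' (Nat.lt_succ_of_le r.reverse_natDegree_le)]
  simp only [LinearMap.sum_apply, map_sum, LinearMap.smul_apply, map_smul, smul_eq_mul]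
  rw [← Finset.sum_range_reflect]
  refine Finset.sum_congr rfl fun i hi => ?_
  have hi' : i ≤ r.natDegree := by simpa [Nat.lt_succ_iff] using hi
  have hidx : r.natDegree + 1 - 1 - i = r.natDegree - i := by omega
  have hpow : T ^ r.natDegree = T ^ (r.natDegree - i) * T ^ i := by
    rw [← pow_add, Nat.sub_add_cancel hi']
  rw [hidx, coeff_reverse, revAt_le hi', hpow, Module.End.mul_apply, apply_pow_pow_of_isometry hT]

/-- If `T` is annihilated by `p ^ 2 * t` with `p * t` reciprocal, then the range of `(p * t)(T)` is
totally isotropic, because `p ^ 2 * t` divides `(p * t) ^ 2`. -/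
theorem apply_aeval_aeval_eq_zero (hT : ∀ u v, h (T u) (T v) = h u v) {p t : K[X]}
    (hrev : IsReciprocal (p * t)) (hann : aeval T (p ^ 2 * t) = 0) (u v : V) :
    h (aeval T (p * t) u) (aeval T (p * t) v) = 0 := by
  have hsq : aeval T (p * t * (p * t)) = 0 := by
    rw [show p * t * (p * t) = p ^ 2 * t * t by ring, map_mul, hann, zero_mul]
  have hcomm (w : V) : (T ^ (p * t).natDegree) (aeval T (p * t) w) =
      aeval T (p * t) ((T ^ (p * t).natDegree) w) := by
    have := congrArg (fun q => aeval T q w) (X_pow_mul (p := p * t) (n := (p * t).natDegree))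
    simpa [Module.End.mul_apply] using this
  rw [← apply_pow_pow_of_isometry hT (p * t).natDegree, hcomm,
    apply_aeval_eq_apply_aeval_reverse hT]
  have hzero : aeval T (p * t) (aeval T (p * t) v) = 0 := by
    rw [← Module.End.mul_apply, ← map_mul, hsq, LinearMap.zero_apply]
  rcases hrev with hr | hr <;> simp only [hr, map_neg, LinearMap.neg_apply, hzero] <;> simp

/-- The isotropic subspace is spanned by the vectors `(p * t * X ^ i)(T) e` with
`i < p.natDegree`, which are independent for degree reasons. -/
theorem exists_isotropic_of_isometry (hT : ∀ u v, h (T u) (T v) = h u v) {n : ℕ} {e : V}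
    (he : ∀ s ∈ degreeLT K n, aeval T s e = 0 → s = 0) {p t : K[X]} (hp : p ≠ 0) (ht : t ≠ 0)
    (hn : (p ^ 2 * t).natDegree ≤ n) (hrev : IsReciprocal (p * t))
    (hann : aeval T (p ^ 2 * t) = 0) :
    ∃ W : Submodule K V, (∀ x ∈ W, ∀ y ∈ W, h x y = 0) ∧ Module.finrank K W = p.natDegree := by
  let φ : K[X] →ₗ[K] V :=
    (LinearMap.applyₗ e).comp ((aeval T).toLinearMap.comp (LinearMap.mulLeft K (p * t)))
  have hφ (s : K[X]) : φ s = aeval T (p * t) (aeval T s e) := by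
    simp [φ, Module.End.mul_apply]
  have hφ' (s : K[X]) : φ s = aeval T (p * t * s) e := rfl
  have hinj : Function.Injective (φ.comp (degreeLT K p.natDegree).subtype) := by
    refine (injective_iff_map_eq_zero _).mpr fun s hs => ?_
    have hmem : p * t * (s : K[X]) ∈ degreeLT K n := by
      by_cases hs0 : (s : K[X]) = 0
      · simp [hs0]
      have hsd : (s : K[X]).natDegree < p.natDegree :=
        (natDegree_lt_iff_degree_lt hs0).mpr (mem_degreeLT.mp s.2)
      rw [mem_degreeLT, ← natDegree_lt_iff_degree_lt (mul_ne_zero (mul_ne_zero hp ht) hs0),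
        natDegree_mul (mul_ne_zero hp ht) hs0, natDegree_mul hp ht]
      rw [natDegree_mul (pow_ne_zero 2 hp) ht, natDegree_pow] at hn
      omega
    have hzero := he _ hmem (by rw [← hφ']; exact hs)
    exact Subtype.ext ((mul_eq_zero.mp hzero).resolve_left (mul_ne_zero hp ht))
  refine ⟨LinearMap.range (φ.comp (degreeLT K p.natDegree).subtype), ?_, ?_⟩
  · rintro _ ⟨s, rfl⟩ _ ⟨s', rfl⟩
    simp only [LinearMap.comp_apply, hφ]
    exact apply_aeval_aeval_eq_zero hT hrev hann _ _
  · rw [LinearMap.finrank_range_of_inj hinj, (degreeLTEquiv K _).finrank_eq, Module.finrank_fin_fun]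

end Isometry

/-! ### Forms preserved by a multiplication and a rank-one perturbation of it -/

/-- An algebra modelled on `K[x]/(F)`, with its involution `x ↦ x⁻¹` and its top coefficient form
`ℓ`, as far as they enter the construction of the invariant form, together with a unit `g` for
which `u ↦ x * u - ℓ u • g` is to be made an isometry. -/
structure InvolutiveDatum (K R : Type*) [Field K] [CommRing R] [Algebra K R] where
  /-- the class of the variable -/
  x : R
  /-- the inverse of `x` -/
  y : R
  /-- the involution exchanging `x` and `y` -/
  σ : R →ₐ[K] R
  /-- the dimension of the algebra -/
  n : ℕ
  /-- the unit giving the direction of the perturbation -/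
  g : R
  /-- the inverse of `g` -/
  gi : R
  /-- the top coefficient form -/
  ℓ : R →ₗ[K] K
  mul_y : x * y = 1
  σ_x : σ x = y
  σ_y : σ y = x
  two_le : 2 ≤ n
  span_pow : Submodule.span K (Set.range fun i : Fin n => x ^ (i : ℕ)) = ⊤
  mul_gi : g * gi = 1
  σ_g : σ g * x ^ n = g
  ℓ_pow : ∀ i, i + 1 < n → ℓ (x ^ i) = 0
  ℓ_top : ℓ (x ^ (n - 1)) = 1
  ℓ_y : ℓ y = 1
  ℓ_y_mul_g : ℓ (y * g) = 2
  ℓ_nondegenerate : ∀ a, (∀ b, ℓ (a * b) = 0) → a = 0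

namespace InvolutiveDatum

variable {K R : Type*} [Field K] [CommRing R] [Algebra K R] (D : InvolutiveDatum K R)

theorem linearMap_ext {M : Type*} [AddCommGroup M] [Module K M] {φ ψ : R →ₗ[K] M}
    (h : ∀ i < D.n, φ (D.x ^ i) = ψ (D.x ^ i)) : φ = ψ :=
  LinearMap.ext_on_range D.span_pow fun i => h i i.2

theorem pow_mul_pow (i : ℕ) : D.x ^ i * D.y ^ i = 1 := by
  rw [← mul_pow, D.mul_y, one_pow]

theorem σ_σ (a : R) : D.σ (D.σ a) = a := by
  have : (D.σ.comp D.σ).toLinearMap = LinearMap.id :=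
    D.linearMap_ext fun i _ => by simp [D.σ_x, D.σ_y]
  exact LinearMap.congr_fun this a

theorem σ_gi : D.σ D.gi = D.x ^ D.n * D.gi := by
  have h : D.σ D.g * D.σ D.gi = 1 := by rw [← map_mul, D.mul_gi, map_one]
  linear_combination (D.x ^ D.n * D.gi) * h - (D.σ D.gi * D.gi) * D.σ_g - D.σ D.gi * D.mul_gi

/-- How `ℓ` changes under the involution; this is what makes the form below symmetric. -/
theorem ℓ_σ (a : R) : D.ℓ (D.x ^ (D.n - 2) * D.σ a) = D.ℓ a := by
  have hn := D.two_le
  have : D.ℓ.comp ((LinearMap.mulLeft K (D.x ^ (D.n - 2))).comp D.σ.toLinearMap) = D.ℓ := by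
    refine D.linearMap_ext fun i hi => ?_
    simp only [LinearMap.comp_apply, LinearMap.mulLeft_apply, AlgHom.toLinearMap_apply, map_pow,
      D.σ_x]
    rcases Nat.lt_or_ge i (D.n - 1) with h | h
    · rw [D.ℓ_pow i (by omega), show D.n - 2 = (D.n - 2 - i) + i by omega, pow_add, mul_assoc,
        D.pow_mul_pow, mul_one, D.ℓ_pow _ (by omega)]
    · obtain rfl : i = D.n - 1 := by omega
      rw [D.ℓ_top, show D.n - 1 = (D.n - 2) + 1 by omega, pow_succ, ← mul_assoc, D.pow_mul_pow,
        one_mul, D.ℓ_y]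
  exact LinearMap.congr_fun this a

/-- The invariant form `(a, b) ↦ ℓ (x ^ (n - 1) * g⁻¹ * σ a * b)`. -/
def form : LinearMap.BilinForm K R :=
  LinearMap.mk₂ K (fun a b => D.ℓ (D.x ^ (D.n - 1) * D.gi * D.σ a * b))
    (fun a a' b => by rw [← map_add]; congr 1; rw [map_add]; ring)
    (fun c a b => by simp)
    (fun a b b' => by rw [← map_add]; congr 1; ring)
    (fun c a b => by simp)

theorem form_apply (a b : R) : D.form a b = D.ℓ (D.x ^ (D.n - 1) * D.gi * D.σ a * b) := rfl

theorem form_comm (a b : R) : D.form a b = D.form b a := by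
  have hn := D.two_le
  rw [form_apply, form_apply, ← D.ℓ_σ]
  congr 1
  simp only [map_mul, map_pow, D.σ_x, D.σ_σ, D.σ_gi]
  obtain ⟨m, hm⟩ : ∃ m, D.n = m + 2 := ⟨D.n - 2, by omega⟩
  simp only [hm, Nat.add_sub_cancel, show m + 2 - 1 = m + 1 by omega]
  linear_combination (D.x ^ (m + 1) * D.gi * a * D.σ b) * D.pow_mul_pow (m + 1)

theorem form_x_mul (a b : R) : D.form (D.x * a) (D.x * b) = D.form a b := by
  rw [form_apply, form_apply, map_mul D.σ, D.σ_x]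
  congr 1
  linear_combination (D.x ^ (D.n - 1) * D.gi * D.σ a * b) * D.mul_y

theorem form_y_mul_g (b : R) : D.form (D.y * D.g) b = D.ℓ b := by
  have hn := D.two_le
  rw [form_apply, map_mul D.σ, D.σ_y]
  congr 1
  have hx : D.x ^ (D.n - 1) * D.x = D.x ^ D.n := by rw [← pow_succ, Nat.sub_add_cancel (by omega)]
  linear_combination (D.gi * D.σ D.g * b) * hx + (D.gi * b) * D.σ_g + b * D.mul_gi

theorem form_g (b : R) : D.form D.g (D.x * b) = D.ℓ b := by
  rw [← D.form_y_mul_g, ← D.form_x_mul (D.y * D.g), ← mul_assoc, D.mul_y, one_mul]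

theorem form_perturbation (a b : R) :
    D.form (D.x * a - D.ℓ a • D.g) (D.x * b - D.ℓ b • D.g) = D.form a b := by
  have hgg : D.form D.g D.g = 2 := by
    rw [← D.ℓ_y_mul_g, ← D.form_g, ← mul_assoc, D.mul_y, one_mul]
  simp only [map_sub, LinearMap.sub_apply, map_smul, LinearMap.smul_apply, smul_eq_mul,
    D.form_x_mul, D.form_g, D.form_comm (D.x * a) D.g, hgg]
  ring

theorem form_nondegenerate : D.form.Nondegenerate := by
  have hleft : D.form.SeparatingLeft := by
    intro a ha
    have h0 : D.x ^ (D.n - 1) * D.gi * D.σ a = 0 := D.ℓ_nondegenerate _ ha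
    have h1 : D.σ a = 0 := by
      linear_combination (D.y ^ (D.n - 1) * D.g) * h0 -
        (D.gi * D.g * D.σ a) * D.pow_mul_pow (D.n - 1) - D.σ a * D.mul_gi
    rw [← D.σ_σ a, h1, map_zero]
  exact ⟨hleft, fun b hb => hleft b fun a => by rw [D.form_comm]; exact hb a⟩

/-- Every invariant form pairs `y * g` with `b` to a multiple of `ℓ b`. As the translates of
`y * g` under powers of `x` span, the form is determined by this multiple. -/
theorem eq_smul_form {h : LinearMap.BilinForm K R} (hsymm : ∀ a b, h a b = h b a)
    (hx : ∀ a b, h (D.x * a) (D.x * b) = h a b)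
    (hpert : ∀ a b, h (D.x * a - D.ℓ a • D.g) (D.x * b - D.ℓ b • D.g) = h a b) :
    ∃ c : K, h = c • D.form := by
  have hg (b : R) : h D.g (D.x * b) = h (D.y * D.g) b := by
    rw [← hx (D.y * D.g), ← mul_assoc, D.mul_y, one_mul]
  refine ⟨h D.g D.g - h (D.y * D.g) (D.x ^ (D.n - 1)), ?_⟩
  set c := h D.g D.g - h (D.y * D.g) (D.x ^ (D.n - 1)) with hc
  have hw (b : R) : h (D.y * D.g) b = c * D.ℓ b := by
    have := hpert (D.x ^ (D.n - 1)) b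
    simp only [map_sub, LinearMap.sub_apply, map_smul, LinearMap.smul_apply, smul_eq_mul, hx,
      hg, hsymm _ D.g, D.ℓ_top] at this
    rw [hc]
    linear_combination -this
  have hpow (k : LinearMap.BilinForm K R) (hk : ∀ a b, k (D.x * a) (D.x * b) = k a b) (i : ℕ)
      (b : R) : k (D.x ^ i * (D.y * D.g)) b = k (D.y * D.g) (D.y ^ i * b) := by
    induction i generalizing b with
    | zero => simp
    | succ i ih =>
      have hb : b = D.x * (D.y * b) := by rw [← mul_assoc, D.mul_y, one_mul]
      rw [pow_succ', mul_assoc]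
      nth_rewrite 1 [hb]
      rw [hk, ih, pow_succ, mul_assoc]
  have hcomp : LinearMap.comp h (LinearMap.mulRight K (D.y * D.g)) =
      LinearMap.comp (c • D.form) (LinearMap.mulRight K (D.y * D.g)) := by
    refine D.linearMap_ext fun i _ => LinearMap.ext fun b => ?_
    simp only [LinearMap.comp_apply, LinearMap.mulRight_apply, LinearMap.smul_apply, smul_eq_mul]
    rw [hpow h hx, hpow D.form D.form_x_mul, hw, D.form_y_mul_g]
  refine LinearMap.ext fun a => ?_
  have ha : a = (a * (D.x * D.gi)) * (D.y * D.g) := by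
    linear_combination (-a) * D.mul_y - (a * D.x * D.y) * D.mul_gi
  rw [ha]
  exact LinearMap.congr_fun hcomp _

end InvolutiveDatum

/-! ### The hypergeometric operators -/

theorem IsReciprocal.map_intCast {p : ℤ[X]} (hp : IsReciprocal p) :
    IsReciprocal (p.map (Int.castRingHom ℚ)) := by
  have hinj : Function.Injective (Int.castRingHom ℚ) := Int.cast_injective
  unfold IsReciprocal
  rw [reverse, natDegree_map_eq_of_injective hinj, reflect_map, ← Polynomial.map_neg]
  exact hp.imp (fun h => congrArg _ h) fun h => congrArg _ h

theorem mul_aeval_reverse {R : Type*} [CommRing R] [Algebra ℚ R] {x y : R} (hxy : x * y = 1)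
    (p : ℚ[X]) : aeval y p.reverse * x ^ p.natDegree = aeval x p := by
  let _ : Invertible x := ⟨y, by rw [mul_comm, hxy], hxy⟩
  exact eval₂_reverse_mul_pow (algebraMap ℚ R) x p

theorem reverse_map_intCast {f : ℤ[X]} (hf : IsCyclotomicProduct f) :
    (f.map (Int.castRingHom ℚ)).reverse = C ((f.eval 0 : ℤ) : ℚ) * f.map (Int.castRingHom ℚ) := by
  have hinj : Function.Injective (Int.castRingHom ℚ) := Int.cast_injective
  have h := congrArg (Polynomial.map (Int.castRingHom ℚ)) (hf.isReciprocal.reverse_eq hf.monic)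
  rw [reverse, ← reflect_map] at h
  rw [reverse, natDegree_map_eq_of_injective hinj, h]
  simp

section Concrete

variable {f : ℤ[X]}

theorem topCoeff_mk (hf : f.Monic) {p : ℚ[X]} (hp : p.degree < f.natDegree) :
    topCoeff hf (AdjoinRoot.mk _ p) = p.coeff (f.natDegree - 1) := by
  have hF := hf.map (Int.castRingHom ℚ)
  rw [topCoeff, LinearMap.comp_apply, AdjoinRoot.modByMonicHom_mk, lcoeff_apply,
    (modByMonic_eq_self_iff hF).mpr]
  rwa [degree_eq_natDegree hF.ne_zero, hf.natDegree_map]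

theorem exists_mk_eq (hf : f.Monic) (a : HypergeometricSpace f) :
    ∃ p : ℚ[X], p.degree < f.natDegree ∧ AdjoinRoot.mk _ p = a := by
  have hF := hf.map (Int.castRingHom ℚ)
  obtain ⟨p, rfl⟩ := AdjoinRoot.mk_surjective a
  refine ⟨p %ₘ f.map (Int.castRingHom ℚ), ?_, ?_⟩
  · have := degree_modByMonic_lt p hF
    rwa [degree_eq_natDegree hF.ne_zero, hf.natDegree_map] at this
  · rw [← AdjoinRoot.modByMonicHom_mk hF, AdjoinRoot.mk_leftInverse hF]

theorem eq_zero_of_mk_eq_zero (hf : f.Monic) {p : ℚ[X]} (hp : p.degree < f.natDegree)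
    (h : AdjoinRoot.mk (f.map (Int.castRingHom ℚ)) p = 0) : p = 0 := by
  refine eq_zero_of_dvd_of_degree_lt (AdjoinRoot.mk_eq_zero.mp h) ?_
  rwa [degree_eq_natDegree (hf.map _).ne_zero, hf.natDegree_map]

theorem topCoeff_nondegenerate (hf : f.Monic) (a : HypergeometricSpace f)
    (ha : ∀ b, topCoeff hf (a * b) = 0) : a = 0 := by
  obtain ⟨p, hp, rfl⟩ := exists_mk_eq hf a
  by_contra hne
  have hp0 : p ≠ 0 := by rintro rfl; simp at hne
  have hpn : p.natDegree < f.natDegree := (natDegree_lt_iff_degree_lt hp0).mpr hp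
  -- Shift the leading coefficient of `p` into the top position.
  have h := ha (AdjoinRoot.mk _ (X ^ (f.natDegree - 1 - p.natDegree)))
  have hidx : f.natDegree - 1 = p.natDegree + (f.natDegree - 1 - p.natDegree) := by omega
  rw [← map_mul, topCoeff_mk hf] at h
  · nth_rewrite 2 [hidx] at h
    rw [coeff_mul_X_pow] at h
    exact hp0 (leadingCoeff_eq_zero.mp h)
  · rw [← natDegree_lt_iff_degree_lt (mul_ne_zero hp0 (pow_ne_zero _ X_ne_zero)),
      natDegree_mul_X_pow _ hp0]
    omega

theorem hypergeometricB_apply (hf : f.Monic) (g : ℤ[X]) (a : HypergeometricSpace f) :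
    hypergeometricB hf g a = AdjoinRoot.root _ * a -
      topCoeff hf a • AdjoinRoot.mk _ (g.map (Int.castRingHom ℚ)) := rfl

theorem root_mul_mk_divX (p : ℚ[X]) :
    AdjoinRoot.root (f.map (Int.castRingHom ℚ)) * AdjoinRoot.mk _ p.divX =
      AdjoinRoot.mk _ p - algebraMap ℚ _ (p.coeff 0) := by
  have h := congrArg (AdjoinRoot.mk (f.map (Int.castRingHom ℚ))) (X_mul_divX_add p)
  rw [map_add, map_mul, AdjoinRoot.mk_X, AdjoinRoot.mk_C] at h
  exact eq_sub_of_add_eq h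

theorem topCoeff_mk_divX (hf : f.Monic) (hn : 0 < f.natDegree) {p : ℚ[X]}
    (hp : p.natDegree ≤ f.natDegree) :
    topCoeff hf (AdjoinRoot.mk _ p.divX) = p.coeff f.natDegree := by
  rw [topCoeff_mk hf, coeff_divX, Nat.sub_add_cancel hn]
  rcases eq_or_ne p.divX 0 with h | h
  · rw [h, degree_zero]; exact WithBot.bot_lt_coe _
  · rw [← natDegree_lt_iff_degree_lt h, natDegree_divX_eq_natDegree_tsub_one]
    omega

theorem root_mul_mk_divX_self (hf0 : f.eval 0 = -1) :
    AdjoinRoot.root (f.map (Int.castRingHom ℚ)) *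
      AdjoinRoot.mk _ (f.map (Int.castRingHom ℚ)).divX = 1 := by
  rw [root_mul_mk_divX, AdjoinRoot.mk_self, coeff_map, coeff_zero_eq_eval_zero, hf0]
  simp

theorem aeval_mk_divX_self (hf : IsCyclotomicProduct f) (hf0 : f.eval 0 = -1) :
    aeval (AdjoinRoot.mk (f.map (Int.castRingHom ℚ)) (f.map (Int.castRingHom ℚ)).divX)
      (f.map (Int.castRingHom ℚ)) = 0 := by
  have hxy := root_mul_mk_divX_self hf0
  have h := mul_aeval_reverse hxy (f.map (Int.castRingHom ℚ))
  rw [reverse_map_intCast hf, hf0, AdjoinRoot.aeval_eq, AdjoinRoot.mk_self] at h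
  have hu := (IsUnit.of_mul_eq_one _ hxy).pow (f.map (Int.castRingHom ℚ)).natDegree
  simpa using (hu.mul_left_eq_zero).mp h

theorem exists_mk_mul_eq_one {g : ℤ[X]} (hfg : ∀ z : ℂ, ¬ (aeval z f = 0 ∧ aeval z g = 0)) :
    ∃ b, AdjoinRoot.mk (f.map (Int.castRingHom ℚ)) (g.map (Int.castRingHom ℚ)) * b = 1 := by
  have hcop : IsCoprime (f.map (Int.castRingHom ℚ)) (g.map (Int.castRingHom ℚ)) := by
    refine (isCoprime_iff_aeval_ne_zero_of_isAlgClosed ℚ ℂ _ _).mpr fun z => ?_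
    have hmap (p : ℤ[X]) : aeval z (p.map (Int.castRingHom ℚ)) = aeval z p :=
      aeval_map_algebraMap ℚ z p
    rw [hmap, hmap]
    exact not_and_or.mp (hfg z)
  obtain ⟨a, b, hab⟩ := hcop
  refine ⟨AdjoinRoot.mk _ b, ?_⟩
  have := congrArg (AdjoinRoot.mk (f.map (Int.castRingHom ℚ))) hab
  simpa [mul_comm] using this

variable {g : ℤ[X]}

/-- The space `ℚ[x]/(f)` with the top coefficient form and the involution `x ↦ x⁻¹`, perturbed in
the direction of the class of `g`. The involution exists because `f` is reciprocal, and
`ℓ (x⁻¹ * g) = 2` because `x⁻¹ * g` is the class of `(f + g) / x`, the constant coefficients of `f` and `g`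
being opposite. -/
noncomputable def hypergeometricDatum (hf : IsCyclotomicProduct f) (hg : IsCyclotomicProduct g)
    (hdeg : g.natDegree = f.natDegree) (hn : 2 ≤ f.natDegree)
    (hf0 : f.eval 0 = -1) (hg0 : g.eval 0 = 1)
    (hfg : ∀ z : ℂ, ¬ (aeval z f = 0 ∧ aeval z g = 0)) :
    InvolutiveDatum ℚ (HypergeometricSpace f) where
  x := AdjoinRoot.root _
  y := AdjoinRoot.mk _ (f.map (Int.castRingHom ℚ)).divX
  σ := AdjoinRoot.liftAlgHom _ (Algebra.ofId ℚ _) _ (aeval_mk_divX_self hf hf0)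
  n := f.natDegree
  g := AdjoinRoot.mk _ (g.map (Int.castRingHom ℚ))
  gi := (exists_mk_mul_eq_one hfg).choose
  ℓ := topCoeff hf.monic
  mul_y := root_mul_mk_divX_self hf0
  σ_x := AdjoinRoot.liftAlgHom_root ..
  σ_y := by
    set σ := AdjoinRoot.liftAlgHom (f.map (Int.castRingHom ℚ)) (Algebra.ofId ℚ _) _
      (aeval_mk_divX_self hf hf0)
    have hxy := root_mul_mk_divX_self hf0
    have h := congrArg σ hxy
    rw [map_mul, map_one, show σ (AdjoinRoot.root _) = _ from AdjoinRoot.liftAlgHom_root ..] at h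
    exact (left_inv_eq_right_inv hxy h).symm
  two_le := hn
  span_pow := by
    refine top_le_iff.mp fun a _ => ?_
    obtain ⟨p, hp, rfl⟩ := exists_mk_eq hf.monic a
    rw [← AdjoinRoot.aeval_eq, aeval_eq_sum_range' (n := f.natDegree)]
    · refine Submodule.sum_mem _ fun i hi => Submodule.smul_mem _ _ (Submodule.subset_span ?_)
      exact ⟨⟨i, Finset.mem_range.mp hi⟩, rfl⟩
    · rcases eq_or_ne p 0 with rfl | h
      · rw [natDegree_zero]; omega
      · exact (natDegree_lt_iff_degree_lt h).mpr hp
  mul_gi := (exists_mk_mul_eq_one hfg).choose_spec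
  σ_g := by
    have hxy := root_mul_mk_divX_self hf0
    have h := mul_aeval_reverse hxy (g.map (Int.castRingHom ℚ))
    rw [reverse_map_intCast hg, hg0, AdjoinRoot.aeval_eq, hg.monic.natDegree_map, hdeg] at h
    simp only [Int.cast_one, C_1, one_mul] at h
    refine Eq.trans ?_ h
    congr 1
  ℓ_pow i hi := by
    rw [← AdjoinRoot.mk_X, ← map_pow, topCoeff_mk, coeff_X_pow, if_neg (by omega)]
    rw [degree_X_pow]; exact_mod_cast (by omega : i < f.natDegree)
  ℓ_top := by
    rw [← AdjoinRoot.mk_X, ← map_pow, topCoeff_mk, coeff_X_pow, if_pos rfl]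
    rw [degree_X_pow]; exact_mod_cast (by omega : f.natDegree - 1 < f.natDegree)
  ℓ_y := by
    have hF := hf.monic.natDegree_map (Int.castRingHom ℚ)
    rw [topCoeff_mk_divX hf.monic (by omega) hF.le, coeff_map, coeff_natDegree,
      hf.monic.leadingCoeff, map_one]
  ℓ_y_mul_g := by
    set F := f.map (Int.castRingHom ℚ) with hF
    set G := g.map (Int.castRingHom ℚ) with hG
    have hxy := root_mul_mk_divX_self hf0
    have h := root_mul_mk_divX (f := f) (F + G)
    have hFd := hf.monic.natDegree_map (Int.castRingHom ℚ)
    have hGd := hg.monic.natDegree_map (Int.castRingHom ℚ)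
    have hc0 : (F + G).coeff 0 = 0 := by
      rw [coeff_add, coeff_map, coeff_map, coeff_zero_eq_eval_zero, coeff_zero_eq_eval_zero, hf0,
        hg0]
      simp
    rw [hc0, map_zero, sub_zero, map_add, ← hF, AdjoinRoot.mk_self, zero_add] at h
    rw [← h, ← mul_assoc, mul_comm (AdjoinRoot.mk F F.divX), hxy, one_mul,
      topCoeff_mk_divX hf.monic (by omega)
        ((natDegree_add_le _ _).trans (max_le hFd.le (hGd.trans hdeg).le)), coeff_add]
    nth_rewrite 2 [← hdeg]
    rw [coeff_map, coeff_map, coeff_natDegree, coeff_natDegree, hf.monic.leadingCoeff,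
      hg.monic.leadingCoeff]
    norm_num
  ℓ_nondegenerate := topCoeff_nondegenerate hf.monic

end Concrete

section Cyclic

variable {f : ℤ[X]}

theorem aeval_hypergeometricA (p : ℚ[X]) (a : HypergeometricSpace f) :
    aeval (hypergeometricA f : Module.End ℚ (HypergeometricSpace f)) p a =
      AdjoinRoot.mk _ p * a := by
  have h := aeval_algHom_apply (Algebra.lmul ℚ (HypergeometricSpace f))
    (AdjoinRoot.root (f.map (Int.castRingHom ℚ))) p
  rw [AdjoinRoot.aeval_eq] at h
  exact LinearMap.congr_fun h a

theorem hypergeometricB_pow_one (hf : f.Monic) (g : ℤ[X]) {i : ℕ} (hi : i < f.natDegree) :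
    ((hypergeometricB hf g : Module.End ℚ (HypergeometricSpace f)) ^ i) 1 =
      AdjoinRoot.mk _ (X ^ i) := by
  induction i with
  | zero => simp
  | succ i ih =>
    rw [pow_succ', Module.End.mul_apply, ih (by omega), hypergeometricB_apply, topCoeff_mk,
      coeff_X_pow, if_neg (by omega), zero_smul, sub_zero, ← AdjoinRoot.mk_X, ← map_mul, pow_succ']
    rw [degree_X_pow]; exact_mod_cast (by omega : i < f.natDegree)

theorem aeval_hypergeometricB_one (hf : f.Monic) (g : ℤ[X]) {p : ℚ[X]}
    (hp : p.degree < f.natDegree) :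
    aeval (hypergeometricB hf g : Module.End ℚ (HypergeometricSpace f)) p 1 =
      AdjoinRoot.mk _ p := by
  rcases eq_or_ne p 0 with rfl | h
  · simp
  have hd := (natDegree_lt_iff_degree_lt h).mpr hp
  rw [← AdjoinRoot.aeval_eq, aeval_eq_sum_range' hd, aeval_eq_sum_range' hd,
    LinearMap.sum_apply]
  refine Finset.sum_congr rfl fun i hi => ?_
  rw [LinearMap.smul_apply, hypergeometricB_pow_one hf g (Finset.mem_range.mp hi), map_pow,
    AdjoinRoot.mk_X]

/-- `B` is annihilated by `g`: the vector `1` is cyclic for `B`, and `B ^ n` maps it to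
`x ^ n - g`. -/
theorem aeval_hypergeometricB_self (hf : f.Monic) {g : ℤ[X]} (hg : g.Monic)
    (hdeg : g.natDegree = f.natDegree) (hn : 0 < f.natDegree) :
    aeval (hypergeometricB hf g : Module.End ℚ (HypergeometricSpace f))
      (g.map (Int.castRingHom ℚ)) = 0 := by
  set B : Module.End ℚ (HypergeometricSpace f) := hypergeometricB hf g with hB
  set G := g.map (Int.castRingHom ℚ) with hG
  have hGm : G.Monic := hg.map _
  have hGd : G.natDegree = f.natDegree := (hg.natDegree_map _).trans hdeg
  have hpow : (B ^ f.natDegree) 1 = AdjoinRoot.mk _ (X ^ f.natDegree) - AdjoinRoot.mk _ G := by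
    obtain ⟨m, hm'⟩ : ∃ m, f.natDegree = m + 1 := ⟨f.natDegree - 1, by omega⟩
    rw [hm', pow_succ', Module.End.mul_apply, hB, hypergeometricB_pow_one hf g (by omega),
      hypergeometricB_apply, topCoeff_mk, coeff_X_pow, if_pos (by omega), one_smul,
      ← AdjoinRoot.mk_X, ← map_mul, pow_succ']
    rw [degree_X_pow]; exact_mod_cast (by omega : m < f.natDegree)
  have hlow : (G - X ^ f.natDegree).degree < (f.natDegree : WithBot ℕ) := by
    have := degree_sub_lt_left (p := G) (q := X ^ f.natDegree)
      (by rw [degree_X_pow, degree_eq_natDegree hGm.ne_zero, hGd]) hGm.ne_zero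
      (by rw [hGm.leadingCoeff, leadingCoeff_X_pow])
    rwa [degree_eq_natDegree hGm.ne_zero, hGd] at this
  have hone : aeval B G 1 = 0 := by
    have h := aeval_hypergeometricB_one hf g hlow
    rw [map_sub, LinearMap.sub_apply, ← hB, aeval_X_pow, hpow, map_sub] at h
    linear_combination h
  refine LinearMap.ext fun a => ?_
  obtain ⟨p, hp, rfl⟩ := exists_mk_eq hf a
  rw [← aeval_hypergeometricB_one hf g hp, ← hB, ← Module.End.mul_apply, ← map_mul, mul_comm,
    map_mul, Module.End.mul_apply, hone, map_zero, LinearMap.zero_apply]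

/-- Both `A` and `B` move the vector `1` through `1, x, …, x ^ (n - 1)`, so a repeated factor of
either characteristic polynomial gives an isotropic subspace. -/
theorem IsHypergeometricForm.exists_isotropic {f g : ℤ[X]} {hf : f.Monic}
    {h : LinearMap.BilinForm ℚ (HypergeometricSpace f)} (hh : IsHypergeometricForm hf g h)
    (hg : g.Monic) (hdeg : g.natDegree = f.natDegree) (hn : 0 < f.natDegree) {p t : ℤ[X]}
    (hp : IsCyclotomicProduct p) (ht : IsCyclotomicProduct t)
    (hpt : f = p ^ 2 * t ∨ g = p ^ 2 * t) :
    ∃ W : Submodule ℚ (HypergeometricSpace f), (∀ x ∈ W, ∀ y ∈ W, h x y = 0) ∧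
      Module.finrank ℚ W = p.natDegree := by
  have hp0 := (hp.monic.map (Int.castRingHom ℚ)).ne_zero
  have ht0 := (ht.monic.map (Int.castRingHom ℚ)).ne_zero
  have hrev : IsReciprocal (p.map (Int.castRingHom ℚ) * t.map (Int.castRingHom ℚ)) :=
    hp.isReciprocal.map_intCast.mul ht.isReciprocal.map_intCast
  have hmap : (p ^ 2 * t).map (Int.castRingHom ℚ) =
      p.map (Int.castRingHom ℚ) ^ 2 * t.map (Int.castRingHom ℚ) := by
    rw [Polynomial.map_mul, Polynomial.map_pow]
  rw [← hp.monic.natDegree_map (Int.castRingHom ℚ)]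
  rcases hpt with hpt | hpt
  · refine exists_isotropic_of_isometry (T := hypergeometricA f) (n := f.natDegree) (e := 1)
      hh.map_A (fun s hs hs0 => ?_) hp0 ht0 ?_ hrev ?_
    · rw [aeval_hypergeometricA, mul_one] at hs0
      exact eq_zero_of_mk_eq_zero hf (mem_degreeLT.mp hs) hs0
    · rw [← hmap, ← hpt, hf.natDegree_map]
    · rw [← hmap, ← hpt]
      exact LinearMap.ext fun a => by
        rw [aeval_hypergeometricA, AdjoinRoot.mk_self, zero_mul, LinearMap.zero_apply]
  · refine exists_isotropic_of_isometry (T := hypergeometricB hf g) (n := f.natDegree) (e := 1)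
      hh.map_B (fun s hs hs0 => ?_) hp0 ht0 ?_ hrev ?_
    · rw [aeval_hypergeometricB_one hf g (mem_degreeLT.mp hs)] at hs0
      exact eq_zero_of_mk_eq_zero hf (mem_degreeLT.mp hs) hs0
    · rw [← hmap, ← hpt, hg.natDegree_map, hdeg]
    · rw [← hmap, ← hpt]
      exact aeval_hypergeometricB_self hf hg hdeg hn

end Cyclic

theorem mainTheorem8 (n : ℕ) (f g : ℤ[X])
    (hf : IsCyclotomicProduct f) (hg : IsCyclotomicProduct g)
    (hfn : f.natDegree = n) (hgn : g.natDegree = n)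
    (hf0 : f.eval 0 = -1) (hg0 : g.eval 0 = 1)
    (hfg : ∀ z : ℂ, ¬ (aeval z f = 0 ∧ aeval z g = 0))
    (hq : ∃ q : ℂ[X], q.natDegree = 2 ∧
      (q ^ 2 ∣ f.map (Int.castRingHom ℂ) ∨ q ^ 2 ∣ g.map (Int.castRingHom ℂ))) :
    (∃ h : LinearMap.BilinForm ℚ (HypergeometricSpace f),
      IsHypergeometricForm hf.monic g h ∧ h ≠ 0) ∧
    ∀ h : LinearMap.BilinForm ℚ (HypergeometricSpace f),
      IsHypergeometricForm hf.monic g h → h ≠ 0 →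
        h.Nondegenerate ∧
        (∀ h' : LinearMap.BilinForm ℚ (HypergeometricSpace f),
          IsHypergeometricForm hf.monic g h' → ∃ c : ℚ, h' = c • h) ∧
        2 ≤ formRank (LinearMap.BilinForm.baseChange ℝ h) ∧
        (7 ≤ n → 2 ≤ formRank h) := by
  have hdeg : g.natDegree = f.natDegree := hgn.trans hfn.symm
  obtain ⟨p, t, hp, ht, hpt, hp2⟩ : ∃ p t : ℤ[X], IsCyclotomicProduct p ∧ IsCyclotomicProduct t ∧
      (f = p ^ 2 * t ∨ g = p ^ 2 * t) ∧ 2 ≤ p.natDegree := by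
    obtain ⟨q, hq2, hq | hq⟩ := hq
    · obtain ⟨p, t, hp, ht, h, h2⟩ := hf.exists_eq_sq_mul hq2 hq
      exact ⟨p, t, hp, ht, Or.inl h, h2⟩
    · obtain ⟨p, t, hp, ht, h, h2⟩ := hg.exists_eq_sq_mul hq2 hq
      exact ⟨p, t, hp, ht, Or.inr h, h2⟩
  have hn : 2 ≤ f.natDegree := by
    have hd : (p ^ 2 * t).natDegree = 2 * p.natDegree + t.natDegree := by
      rw [(hp.monic.pow 2).natDegree_mul ht.monic, hp.monic.natDegree_pow]
    rcases hpt with h | h <;> rw [← h] at hd <;> omega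
  have := (hf.monic.map (Int.castRingHom ℚ)).finite_adjoinRoot
  let D := hypergeometricDatum hf hg hdeg hn hf0 hg0 hfg
  have huniq (h : LinearMap.BilinForm ℚ (HypergeometricSpace f))
      (hh : IsHypergeometricForm hf.monic g h) : ∃ c : ℚ, h = c • D.form :=
    D.eq_smul_form hh.symm hh.map_A hh.map_B
  have : Nontrivial (HypergeometricSpace f) := by
    refine AdjoinRoot.nontrivial _ ?_
    rw [degree_eq_natDegree (hf.monic.map _).ne_zero, hf.monic.natDegree_map]
    exact_mod_cast (by omega : f.natDegree ≠ 0)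
  refine ⟨⟨D.form, ⟨D.form_comm, D.form_x_mul, D.form_perturbation⟩,
    D.form_nondegenerate.ne_zero⟩, fun h hh hne => ?_⟩
  obtain ⟨W, hW, hWd⟩ := hh.exists_isotropic hg.monic hdeg (by omega) hp ht hpt
  obtain ⟨c, rfl⟩ := huniq h hh
  have hc : c ≠ 0 := by rintro rfl; simp at hne
  refine ⟨?_, fun h' hh' => ?_, ?_, fun _ => ?_⟩
  · have hnd := D.form_nondegenerate
    refine ⟨fun a ha => hnd.1 a fun b => ?_, fun b hb => hnd.2 b fun a => ?_⟩
    · simpa [hc] using ha b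
    · simpa [hc] using hb a
  · obtain ⟨c', rfl⟩ := huniq h' hh'
    exact ⟨c' / c, by rw [smul_smul, div_mul_cancel₀ c' hc]⟩
  · exact (hp2.trans hWd.ge).trans (le_formRank_baseChange W hW)
  · exact (hp2.trans hWd.ge).trans (le_formRank W hW)
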